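/- **Conventions.** Let $M$ be a closed oriented 3-manifold and $b=(b_i)_{i\in I}$ an oriented framed link in $M$ with finitely many components. Call $b$ *$H_1$-spanning* if the classes $[b_i]$ generate $H_1(M;\mathbb Z)$; call a sublink *rationally $H_1$-spanning* if the classes of its components span $H_1(M;\mathbb Q)$. A *graph* is a finite, possibly disconnected graph with univalent vertices (*legs*) and trivalent vertices, with a cyclic order at each trivalent vertex, and without struts (edges joining two univalent vertices). Multiple edges and edges joining a trivalent vertex to itself are allowed. It is *$X$-colored* if its legs are labelled by elements of $X$; labels that are formal $\mathbb Z$-linear combinations of elements of $X$ are expanded linearly. $\mathcal B(X)$ is the abelian group generated by isomorphism classes of $X$-colored graphs modulo the relations AS, IHX and LOOP (a graph with an edge joining a trivalent vertex to itself is $0$). Write $\mathcal B(b)$ for $\mathcal B(X)$ with $X$ the set of components of $b$, and $c_l$ for the color of a leg $l$. For a graph $G$ with a distinguished leg $\ast$ and another leg $l$, let $G_l$ be the result of gluing $\ast$ to $l$ (so that the two edges ending there become one edge). Then $\mathcal A(b)$ is the quotient of $\mathcal B(b)$ by the closed brane relations $$\sum_l\,([\Sigma]\cdot[c_l])\,G_l=0$$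 for all closed oriented surfaces $\Sigma$ in $M$ (all classes $[\Sigma]\in H_2(M;\mathbb Z)$) and all graphs $G$ with a distinguished leg $\ast$ whose other legs are colored by $b$, where the sum is over the legs $l\ne\ast$ and $\cdot$ is the intersection pairing. And $\mathcal A^{\mathrm o}(b)$ is the quotient of $\mathcal A(b)$ by the open brane relations $$G+\sum_l\,([\Sigma_0]\cdot[c_l])\,G_l=0$$ for all graphs $G$ with a distinguished leg $\ast$, whose other legs are colored by $b$ and whose leg $\ast$ is colored by a nonzero formal combination $c_0=\sum_i a_ib_i$ $(a_i\in\mathbb Z)$ that bounds a surface $\Sigma_0$ in $M$, where the sum is over the legs $l\neq\ast$ and the curves $c_l$ are pushed off $\partial\Sigma_0$ along the framing. **Corollary.** Let $b$ be an $H_1$-spanning link in a closed oriented 3-manifold $M$, let $b'$ be a sublink of $b$ that is not rationally $H_1$-spanning, and let $G$ be a $b'$-colored graph that has an internal edge, that is, an edge between two trivalent vertices. Then $G=0$ in $\mathcal A^{\mathrm o}(b)$. In particular, if $b_1(M)>0$, then every nonempty graph without legs vanishes in $\mathcal A^{\mathrm o}(b)$. -/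

import Mathlib

noncomputable section

namespace FTI

open scoped Classical

/-! ## Singular chains -/

/-- Singular `n`-simplices of `M`. -/
abbrev Simplex (M : Type*) [TopologicalSpace M] (n : ℕ) : Type _ :=
  C(stdSimplex ℝ (Fin (n + 1)), M)

/-- The restriction of a singular simplex along a map of vertices, for example to the face
spanned by some of its vertices. -/
def Simplex.restrict {M : Type*} [TopologicalSpace M] {m n : ℕ}
    (s : Simplex M n) (θ : Fin (m + 1) → Fin (n + 1)) : Simplex M m :=
  s.comp ⟨stdSimplex.map θ, stdSimplex.continuous_map θ⟩

/-- Singular `n`-chains of `M` with coefficients in `R`. -/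
abbrev Chain (R : Type*) [CommRing R] (M : Type*) [TopologicalSpace M] (n : ℕ) : Type _ :=
  Simplex M n →₀ R

/-- The boundary operator `∑ᵢ (-1)ⁱ dᵢ`. -/
def boundary (R : Type*) [CommRing R] (M : Type*) [TopologicalSpace M] (n : ℕ) :
    Chain R M (n + 1) →ₗ[R] Chain R M n :=
  Finsupp.linearCombination R fun s : Simplex M (n + 1) =>
    ∑ i : Fin (n + 2), Finsupp.single (s.restrict i.succAbove) ((-1 : R) ^ (i : ℕ))

/-- The chains all of whose simplices lie in the subset `S`. -/
def chainsIn (R : Type*) [CommRing R] {M : Type*} [TopologicalSpace M] (S : Set M) (n : ℕ) :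
    Submodule R (Chain R M n) :=
  Finsupp.supported R R {s : Simplex M n | Set.range s ⊆ S}

/-- The homology `ker g / im f` at `B` of `A → B → C`. -/
abbrev Homology {R A B C : Type*} [CommRing R] [AddCommGroup A] [AddCommGroup B] [AddCommGroup C]
    [Module R A] [Module R B] [Module R C] (f : A →ₗ[R] B) (g : B →ₗ[R] C) : Type _ :=
  LinearMap.ker g ⧸ (LinearMap.range f).submoduleOf (LinearMap.ker g)

/-- `H₁(M; R)`: the 1-cycles modulo the 1-boundaries. -/
def H1 (R : Type*) [CommRing R] (M : Type*) [TopologicalSpace M] : Type _ :=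
  Homology (boundary R M 1) (boundary R M 0)

instance (R : Type*) [CommRing R] (M : Type*) [TopologicalSpace M] : AddCommGroup (H1 R M) :=
  inferInstanceAs (AddCommGroup (Homology (boundary R M 1) (boundary R M 0)))

instance (R : Type*) [CommRing R] (M : Type*) [TopologicalSpace M] : Module R (H1 R M) :=
  inferInstanceAs (Module R (Homology (boundary R M 1) (boundary R M 0)))

/-- The class of a 1-cycle in `H₁(M; R)`. -/
def H1.mk {R : Type*} [CommRing R] {M : Type*} [TopologicalSpace M] (z : Chain R M 1)
    (hz : boundary R M 0 z = 0) : H1 R M :=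
  (Submodule.Quotient.mk ⟨z, hz⟩ : Homology (boundary R M 1) (boundary R M 0))

/-- The first Betti number. -/
def b1 (M : Type*) [TopologicalSpace M] : ℕ := Module.finrank ℚ (H1 ℚ M)

/-- The singular 1-simplex that runs once around a loop `Circle → M`, counterclockwise. -/
def loopSimplex {M : Type*} [TopologicalSpace M] (c : C(Circle, M)) : Simplex M 1 :=
  c.comp ⟨fun t => Circle.exp (2 * Real.pi * t.1 1),
    Circle.exp.continuous.comp
      (continuous_const.mul ((continuous_apply (1 : Fin 2)).comp continuous_subtype_val))⟩

/-- A loop as a singular 1-chain. -/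
def loopChain (R : Type*) [CommRing R] {M : Type*} [TopologicalSpace M] (c : C(Circle, M)) :
    Chain R M 1 :=
  Finsupp.single (loopSimplex c) 1

theorem boundary_loopChain (R : Type*) [CommRing R] {M : Type*} [TopologicalSpace M]
    (c : C(Circle, M)) : boundary R M 0 (loopChain R c) = 0 := by
  have h : (loopSimplex c).restrict (m := 0) (Fin.succAbove 0) =
      (loopSimplex c).restrict (m := 0) (Fin.succAbove 1) := by
    ext t
    have ht : t = stdSimplex.vertex 0 := Subsingleton.elim _ _
    subst ht
    simp [loopSimplex, Simplex.restrict, stdSimplex.map_vertex]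
  rw [boundary, loopChain, Finsupp.linearCombination_single, Fin.sum_univ_two, h]
  simp [← Finsupp.single_add, -Finsupp.single_neg]

/-- The class of a loop in `H₁(M; R)`. -/
def loopClass (R : Type*) [CommRing R] {M : Type*} [TopologicalSpace M] (c : C(Circle, M)) :
    H1 R M :=
  H1.mk (loopChain R c) (boundary_loopChain R c)

/-! ## Orientation and the intersection pairing of a closed 3-manifold -/

/-- `μ` is a cycle that represents a fundamental class (an orientation) of the closed
3-manifold `M`: for every point `x`, its class generates `H₃(M, M ∖ {x}; ℤ)`. -/
def IsFundamentalCycle {M : Type*} [TopologicalSpace M] (μ : Chain ℤ M 3) : Prop :=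
  boundary ℤ M 2 μ = 0 ∧
    ∀ (x : M) (z : Chain ℤ M 3), boundary ℤ M 2 z ∈ chainsIn ℤ {x}ᶜ 2 →
      ∃ n : ℤ, z - n • μ ∈ LinearMap.range (boundary ℤ M 3) ⊔ chainsIn ℤ {x}ᶜ 3

/-- The cap product of a 3-chain with a 1-cochain `α`:
`[v₀,v₁,v₂,v₃] ↦ α [v₀,v₁] • [v₁,v₂,v₃]`. -/
def cap {M : Type*} [TopologicalSpace M] (α : Chain ℤ M 1 →ₗ[ℤ] ℤ) :
    Chain ℤ M 3 →ₗ[ℤ] Chain ℤ M 2 :=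
  Finsupp.linearCombination ℤ fun s : Simplex M 3 =>
    Finsupp.single (s.restrict (m := 2) Fin.succ)
      (α (Finsupp.single (s.restrict (m := 1) ![0, 1]) 1))

/-- Let `K` be a compact subset and `σ` a 2-chain with boundary in `K`.
The 1-cochain `α` restricts to a cocycle of `M ∖ K` whose class corresponds to the class of `σ`
under the Poincaré–Lefschetz duality isomorphism `H¹(M ∖ K) ≅ H₂(M, K)`, that is, under
`H¹(M ∖ K) → H₂(M ∖ K, N ∖ K) ≅ H₂(M, N)`, the cap product with
`[M] ∈ H₃(M, N) ≅ H₃(M ∖ K, N ∖ K)`, for all open neighbourhoods `N` of `K`.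
(The fundamental class is represented by `p + q` with `p` in `M ∖ K` and `q` in `N`.)
For `K = ∅` this says that `α` is a cocycle and that the cap product of `[M]` with `[α]`
is `[σ]` in `H₂(M)`. -/
def IsDual {M : Type*} [TopologicalSpace M] (μ : Chain ℤ M 3) (K : Set M)
    (σ : Chain ℤ M 2) (α : Chain ℤ M 1 →ₗ[ℤ] ℤ) : Prop :=
  (∀ τ ∈ chainsIn ℤ Kᶜ 2, α (boundary ℤ M 1 τ) = 0) ∧
    ∀ N : Set M, IsOpen N → K ⊆ N →
      ∃ p ∈ chainsIn ℤ Kᶜ 3, ∃ q ∈ chainsIn ℤ N 3, ∃ r ∈ chainsIn ℤ N 2,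
        p + q - μ ∈ LinearMap.range (boundary ℤ M 3) ∧
        cap α p - σ - r ∈ LinearMap.range (boundary ℤ M 2)

/-- `n` is the intersection number `[σ] · [γ]` of the class in `H₂(M, K)` of a 2-chain `σ`
with boundary in `K`, and the class in `H₁(M ∖ K)` of a 1-cycle `γ` of `M ∖ K`:
the value on `γ` of the Poincaré–Lefschetz dual of `σ`. For `K = ∅` this is the intersection
pairing of `H₂(M)` and `H₁(M)`. -/
def IsIntersectionNumber {M : Type*} [TopologicalSpace M] (μ : Chain ℤ M 3) (K : Set M)
    (σ : Chain ℤ M 2) (γ : Chain ℤ M 1) (n : ℤ) : Prop :=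
  ∃ α : Chain ℤ M 1 →ₗ[ℤ] ℤ, IsDual μ K σ α ∧ α γ = n

/-! ## Framed links -/

/-- An oriented framed link in `M` with components indexed by `ι`: disjointly embedded solid
tori `S¹ × D²`. The `i`-th component is the core `S¹ × {0}`, oriented by `S¹`, and its framing
is given by the parallel curve `S¹ × {1}`. -/
structure FramedLink (ι : Type*) (M : Type*) [TopologicalSpace M] where
  tube : ι → C(Circle × Metric.closedBall (0 : ℂ) 1, M)
  injective : Function.Injective
    fun x : ι × (Circle × Metric.closedBall (0 : ℂ) 1) => tube x.1 x.2

namespace FramedLink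

variable {ι : Type*} {M : Type*} [TopologicalSpace M] (b : FramedLink ι M)

/-- The `i`-th component. -/
def core (i : ι) : C(Circle, M) :=
  (b.tube i).comp ⟨fun z => (z, ⟨0, by simp⟩), by fun_prop⟩

/-- The copy of the `i`-th component that is pushed off along the framing. -/
def parallel (i : ι) : C(Circle, M) :=
  (b.tube i).comp ⟨fun z => (z, ⟨1, by simp⟩), by fun_prop⟩

/-- The union of the components. -/
def support : Set M := ⋃ i, Set.range (b.core i)

/-- The components indexed by `S` span `H₁(M; R)`. -/
def Spans (R : Type*) [CommRing R] (S : Set ι) : Prop :=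
  Submodule.span R ((fun i => loopClass R (b.core i)) '' S) = ⊤

/-- The link generates `H₁(M; ℤ)`. -/
def IsH1Spanning : Prop := b.Spans ℤ Set.univ

end FramedLink

/-! ## Uni-trivalent graphs -/

/-- A finite graph with univalent and trivalent vertices, a cyclic order of the edge ends at
every trivalent vertex, and no strut. It is given by its set `H` of half-edges: `edge` sends a
half-edge to the other half of its edge, and `vert` to its successor in the cyclic order at its
vertex. The vertices are the orbits of `vert`, which have one or three elements. -/
structure UTGraph where
  H : Type
  finite : Finite H
  edge : H → H
  vert : H → H
  edge_edge : ∀ h, edge (edge h) = h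
  edge_ne : ∀ h, edge h ≠ h
  vert_cube : ∀ h, vert (vert (vert h)) = h
  no_strut : ∀ h, vert h = h → vert (edge h) ≠ edge h

attribute [instance] UTGraph.finite

namespace UTGraph

/-- The legs (univalent vertices). -/
abbrev Leg (Γ : UTGraph) : Type := {h : Γ.H // Γ.vert h = h}

/-- There is an edge both of whose ends are at trivalent vertices. -/
def HasInternalEdge (Γ : UTGraph) : Prop :=
  ∃ h, Γ.vert h ≠ h ∧ Γ.vert (Γ.edge h) ≠ Γ.edge h

theorem vert_conj_fixed {Γ : UTGraph} {π : Equiv.Perm Γ.H} (hπ : ∀ h, Γ.vert h = h → π h = h)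
    (h : Γ.H) : π (Γ.vert (π.symm h)) = h ↔ Γ.vert h = h := by
  constructor
  · intro e
    have e1 : Γ.vert (π.symm h) = π.symm h := by rw [Equiv.eq_symm_apply]; exact e
    have e2 := hπ _ e1
    rw [Equiv.apply_symm_apply] at e2
    rwa [← e2] at e1
  · intro e
    have e1 : π.symm h = h := by rw [Equiv.symm_apply_eq]; exact (hπ h e).symm
    rw [e1, e, hπ h e]

/-- The graph obtained by permuting the places of the half-edges at the trivalent vertices:
`π h` takes the place of `h`, so that a vertex `(x y z)` becomes `(π x π y π z)`, and the edges
are kept. -/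
def rearrange (Γ : UTGraph) (π : Equiv.Perm Γ.H) (hπ : ∀ h, Γ.vert h = h → π h = h) :
    UTGraph where
  H := Γ.H
  finite := Γ.finite
  edge := Γ.edge
  vert h := π (Γ.vert (π.symm h))
  edge_edge := Γ.edge_edge
  edge_ne := Γ.edge_ne
  vert_cube h := by simp [Γ.vert_cube]
  no_strut h := by
    intro e
    rw [vert_conj_fixed hπ] at e
    rw [Ne, vert_conj_fixed hπ]
    exact Γ.no_strut h e

/-- The graph obtained by gluing two different legs: the two legs are removed and the two edges
that end there are joined into one edge. -/
def glue (Γ : UTGraph) (k l : Γ.Leg) (hkl : l ≠ k) : UTGraph where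
  H := {h : Γ.H // h ≠ k.1 ∧ h ≠ l.1}
  finite := inferInstance
  edge h :=
    if hk : Γ.edge h.1 = k.1 then ⟨Γ.edge l.1, by
      refine ⟨fun e => ?_, Γ.edge_ne _⟩
      apply Γ.no_strut _ l.2
      rw [e, k.2]⟩
    else if hl : Γ.edge h.1 = l.1 then ⟨Γ.edge k.1, by
      refine ⟨Γ.edge_ne _, fun e => ?_⟩
      apply Γ.no_strut _ k.2
      rw [e, l.2]⟩
    else ⟨Γ.edge h.1, hk, hl⟩
  vert h := ⟨Γ.vert h.1, by
    constructor
    · intro e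
      apply h.2.1
      rw [← Γ.vert_cube h.1, e, k.2, k.2]
    · intro e
      apply h.2.2
      rw [← Γ.vert_cube h.1, e, l.2, l.2]⟩
  edge_edge := by
    rintro ⟨h, h1, h2⟩
    have hkl' : l.1 ≠ k.1 := fun e => hkl (Subtype.ext e)
    have ek := Γ.edge_edge k.1
    have el := Γ.edge_edge l.1
    have eh := Γ.edge_edge h
    dsimp only
    grind
  edge_ne := by
    rintro ⟨h, h1, h2⟩
    have hkl' : l.1 ≠ k.1 := fun e => hkl (Subtype.ext e)
    have ek := Γ.edge_edge k.1
    have el := Γ.edge_edge l.1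
    have eh := Γ.edge_edge h
    have hne := Γ.edge_ne h
    dsimp only
    grind
  vert_cube h := Subtype.ext (Γ.vert_cube h.1)
  no_strut := by
    rintro ⟨h, h1, h2⟩ e
    have e' : Γ.vert h = h := congrArg Subtype.val e
    have a := Γ.no_strut _ e'
    have a1 := Γ.no_strut _ k.2
    have a2 := Γ.no_strut _ l.2
    dsimp only
    split_ifs with c1 c2
    · intro c; exact a2 (congrArg Subtype.val c)
    · intro c; exact a1 (congrArg Subtype.val c)
    · intro c; exact a (congrArg Subtype.val c)

end UTGraph

/-- An `X`-colored graph. -/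
structure ColoredGraph (X : Type*) extends UTGraph where
  color : toUTGraph.Leg → X

namespace ColoredGraph

variable {X : Type*}

/-- Isomorphism of colored graphs. -/
def Isomorphic (G G' : ColoredGraph X) : Prop :=
  ∃ e : G.H ≃ G'.H, (∀ h, e (G.edge h) = G'.edge (e h)) ∧
    (∀ h, e (G.vert h) = G'.vert (e h)) ∧
    ∀ (l : G.Leg) (l' : G'.Leg), e l.1 = l'.1 → G.color l = G'.color l'

/-- See `UTGraph.rearrange`. -/
def rearrange (G : ColoredGraph X) (π : Equiv.Perm G.H) (hπ : ∀ h, G.vert h = h → π h = h) :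
    ColoredGraph X where
  toUTGraph := G.toUTGraph.rearrange π hπ
  color l := G.color ⟨l.1, (UTGraph.vert_conj_fixed hπ l.1).1 l.2⟩

end ColoredGraph

/-- A graph `(G, ∗)` with a distinguished leg `∗`, whose other legs are colored by `X`. -/
structure StarGraph (X : Type*) extends UTGraph where
  star : toUTGraph.Leg
  color : {l : toUTGraph.Leg // l ≠ star} → X

namespace StarGraph

variable {X : Type*}

instance (G : StarGraph X) : Fintype {l : G.Leg // l ≠ G.star} := Fintype.ofFinite _

/-- Color the leg `∗` by `x`. -/
def fill (G : StarGraph X) (x : X) : ColoredGraph X where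
  toUTGraph := G.toUTGraph
  color l := if hl : l = G.star then x else G.color ⟨l, hl⟩

/-- Glue the leg `∗` to the leg `l`. -/
def glue (G : StarGraph X) (l : {l : G.Leg // l ≠ G.star}) : ColoredGraph X where
  toUTGraph := G.toUTGraph.glue G.star l.1 l.2
  color k := G.color ⟨⟨k.1.1, congrArg Subtype.val k.2⟩, fun e =>
    k.1.2.1 (congrArg Subtype.val e)⟩

end StarGraph

/-! ## The groups of graphs -/

section Groups

variable {X : Type*}

/-- Isomorphic graphs are equal. -/
def isoRelations (X : Type*) : Set (FreeAbelianGroup (ColoredGraph X)) :=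
  {x | ∃ G G' : ColoredGraph X, G.Isomorphic G' ∧
    x = FreeAbelianGroup.of G - FreeAbelianGroup.of G'}

/-- AS: reversing the cyclic order at one trivalent vertex `(a p q)` changes the sign. -/
def asRelations (X : Type*) : Set (FreeAbelianGroup (ColoredGraph X)) :=
  {x | ∃ (G : ColoredGraph X) (a : G.H) (π : Equiv.Perm G.H)
    (hπ : ∀ h, G.vert h = h → π h = h),
    G.vert a ≠ a ∧ π = Equiv.swap (G.vert a) (G.vert (G.vert a)) ∧
    x = FreeAbelianGroup.of G + FreeAbelianGroup.of (G.rearrange π hπ)}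

/-- IHX: for an edge `{a, a'}` that joins two different trivalent vertices `(a p q)` and
`(a' r s)`, the sum of the three graphs in which these vertices are
`(a p q), (a' r s)`, respectively `(a q r), (a' p s)`, respectively `(a r p), (a' q s)`,
and which agree elsewhere, vanishes. -/
def ihxRelations (X : Type*) : Set (FreeAbelianGroup (ColoredGraph X)) :=
  {x | ∃ (G : ColoredGraph X) (a a' p q r : G.H) (π : Equiv.Perm G.H)
    (hπ : ∀ h, G.vert h = h → π h = h) (hππ : ∀ h, G.vert h = h → (π * π) h = h),
    a' = G.edge a ∧ G.vert a ≠ a ∧ G.vert a' ≠ a' ∧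
    p = G.vert a ∧ q = G.vert p ∧ r = G.vert a' ∧ a' ≠ p ∧ a' ≠ q ∧
    π = Equiv.swap p q * Equiv.swap q r ∧
    x = FreeAbelianGroup.of G + FreeAbelianGroup.of (G.rearrange π hπ) +
      FreeAbelianGroup.of (G.rearrange (π * π) hππ)}

/-- LOOP: a graph with an edge that joins a trivalent vertex to itself vanishes. -/
def loopRelations (X : Type*) : Set (FreeAbelianGroup (ColoredGraph X)) :=
  {x | ∃ (G : ColoredGraph X) (h : G.H), G.edge h = G.vert h ∧ x = FreeAbelianGroup.of G}

/-- The group `𝓑(X)`. -/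
abbrev GroupB (X : Type*) : Type _ :=
  FreeAbelianGroup (ColoredGraph X) ⧸
    AddSubgroup.closure (isoRelations X ∪ asRelations X ∪ ihxRelations X ∪ loopRelations X)

/-- The class of a graph in `𝓑(X)`. -/
def toB (G : ColoredGraph X) : GroupB X :=
  QuotientAddGroup.mk (FreeAbelianGroup.of G)

/-- `∑ₗ n(cₗ) Gₗ`, summed over the legs `l` of `G` other than `∗`, where `cₗ` is the color of
`l`, and `Gₗ` is the result of gluing `∗` to `l`. -/
def gluingSum (n : X → ℤ) (G : StarGraph X) : GroupB X :=
  ∑ l : {l : G.Leg // l ≠ G.star}, n (G.color l) • toB (G.glue l)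

end Groups

section LinkGroups

variable {ι M : Type*} [TopologicalSpace M]

/-- The closed brane relations: `∑ₗ ([Σ] · [cₗ]) Gₗ` for all graphs `(G, ∗)` and all closed
surfaces, that is, classes `[Σ]` in `H₂(M)`. -/
def brRelations (μ : Chain ℤ M 3) (b : FramedLink ι M) : Set (GroupB ι) :=
  {x | ∃ (G : StarGraph ι) (σ : Chain ℤ M 2) (n : ι → ℤ),
    boundary ℤ M 1 σ = 0 ∧
    (∀ i, IsIntersectionNumber μ ∅ σ (loopChain ℤ (b.core i)) (n i)) ∧
    x = gluingSum n G}

/-- The group `𝓐(b) = 𝓑(b) / BR`. -/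
abbrev GroupA (μ : Chain ℤ M 3) (b : FramedLink ι M) : Type _ :=
  GroupB ι ⧸ AddSubgroup.closure (brRelations μ b)

/-- The open brane relations: `G + ∑ₗ ([Σ₀] · [cₗ]) Gₗ`, where the leg `∗` of `G` is colored by a
nonzero formal linear combination `c₀ = ∑ᵢ aᵢ bᵢ` of components of `b` (and `G` is expanded
linearly in this color) which bounds `Σ₀`. The other legs `cₗ` are pushed off along the
framing. -/
def obrRelations (μ : Chain ℤ M 3) (b : FramedLink ι M) : Set (GroupB ι) :=
  {x | ∃ (G : StarGraph ι) (a : ι →₀ ℤ) (σ : Chain ℤ M 2) (n : ι → ℤ),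
    a ≠ 0 ∧
    boundary ℤ M 1 σ = a.sum (fun i m => m • loopChain ℤ (b.core i)) ∧
    (∀ i, IsIntersectionNumber μ b.support σ (loopChain ℤ (b.parallel i)) (n i)) ∧
    x = a.sum (fun i m => m • toB (G.fill i)) + gluingSum n G}

/-- The group `𝓐ᵒ(b) = 𝓐(b) / OBR`. -/
abbrev GroupAo (μ : Chain ℤ M 3) (b : FramedLink ι M) : Type _ :=
  GroupA μ b ⧸ AddSubgroup.closure
    ((QuotientAddGroup.mk : GroupB ι → GroupA μ b) '' obrRelations μ b)

/-- The class of a graph in `𝓐ᵒ(b)`. -/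
def toAo (μ : Chain ℤ M 3) (b : FramedLink ι M) (G : ColoredGraph ι) : GroupAo μ b :=
  QuotientAddGroup.mk (QuotientAddGroup.mk (toB G) : GroupA μ b)

end LinkGroups

end FTI

end

/-! A graph with an internal edge vanishes because of closed brane relations alone.

Since the components in `S` do not span `H₁(M; ℚ)`, the quotient of `H₁(M; ℤ)` by their classes is
not torsion (`FramedLink.spans_rat_of_torsion`). It is finitely generated because the link spans
`H₁(M; ℤ)`, so there is a surjective functional `φ : H₁(M; ℤ) → ℤ` that vanishes on the components
in `S` (`exists_linearMap_vanishing_of_not_torsion`). This functional is the intersection pairing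
with a closed surface `Σ` (`exists_closed_surface`): a cocycle `α` that represents `φ` is dual to
the cap product `[M] ∩ α`, so that Poincaré duality is needed only in its trivial direction.

Now cut an internal edge of a graph `G` with colors in `S`, let one of the two new legs be the
distinguished leg, and color the other one by an arbitrary component `bᵢ`. In the closed brane
relation for `Σ` the old legs contribute nothing, since `φ` vanishes on their colors, and gluing the
two new legs restores `G` (`gluingSum_cut`). Hence `φ(bᵢ) G = 0` for all `i`. As the `bᵢ` generate
`H₁(M; ℤ)` and `φ` takes the value `1`, it follows that `G = 0`.

If `b₁(M) > 0`, the empty sublink is not rationally spanning, and every edge of a graph without legs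
is internal. -/

noncomputable section

open scoped Classical

namespace FTI

/-! ### Functionals on finitely generated modules over a principal ideal domain -/

/-- If some element has no nonzero multiple in the span `N` of the `v i`, `i ∈ S`, then `A ⧸ N`
modulo torsion is a nonzero finitely generated free module; the functional is one of its
coordinates. -/
theorem exists_linearMap_vanishing_of_not_torsion {R ι A : Type*} [CommRing R] [IsDomain R]
    [IsPrincipalIdealRing R] [Finite ι] [AddCommGroup A] [Module R A] (v : ι → A)
    (hv : Submodule.span R (Set.range v) = ⊤) (S : Set ι) {x : A}
    (hx : ∀ k : R, k ≠ 0 → k • x ∉ Submodule.span R (v '' S)) :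
    ∃ φ : A →ₗ[R] R, (∀ i ∈ S, φ (v i) = 0) ∧ ∃ y, φ y = 1 := by
  let N := Submodule.span R (v '' S)
  let T := Submodule.torsion R (A ⧸ N)
  have : Module.Finite R A := ⟨by
    rw [← hv]; exact Submodule.fg_span (Set.finite_range v)⟩
  have hnt : T.mkQ (N.mkQ x) ≠ 0 := by
    intro h
    rw [Submodule.mkQ_apply, Submodule.Quotient.mk_eq_zero, Submodule.mem_torsion_iff] at h
    obtain ⟨⟨k, hk⟩, h⟩ := h
    refine hx k (nonZeroDivisors.ne_zero hk) ?_
    have h' : N.mkQ (k • x) = 0 := by rw [map_smul]; exact h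
    rwa [Submodule.mkQ_apply, Submodule.Quotient.mk_eq_zero] at h'
  have : Nontrivial ((A ⧸ N) ⧸ T) := ⟨_, _, hnt⟩
  let B := Module.Free.chooseBasis R ((A ⧸ N) ⧸ T)
  obtain ⟨j⟩ : Nonempty (Module.Free.ChooseBasisIndex R ((A ⧸ N) ⧸ T)) := B.index_nonempty
  refine ⟨B.coord j ∘ₗ T.mkQ ∘ₗ N.mkQ, fun i hi => ?_, ?_⟩
  · have : N.mkQ (v i) = 0 := by
      rw [Submodule.mkQ_apply, Submodule.Quotient.mk_eq_zero]
      exact Submodule.subset_span ⟨i, hi, rfl⟩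
    simp [this]
  · obtain ⟨y, hy⟩ := T.mkQ_surjective (B j)
    obtain ⟨z, rfl⟩ := N.mkQ_surjective y
    exact ⟨z, by rw [LinearMap.comp_apply, LinearMap.comp_apply, hy]; simp⟩

theorem eq_zero_of_forall_smul_eq_zero {R ι A D : Type*} [CommRing R] [AddCommGroup A]
    [Module R A] [AddCommGroup D] [Module R D] (v : ι → A)
    (hv : Submodule.span R (Set.range v) = ⊤) (φ : A →ₗ[R] R) (hφ : ∃ y, φ y = 1) {d : D}
    (hd : ∀ i, φ (v i) • d = 0) : d = 0 := by
  obtain ⟨y, hy⟩ := hφ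
  have key : φ.smulRight d = 0 :=
    LinearMap.ext_on_range hv fun i => hd i
  simpa [hy] using LinearMap.congr_fun key y

/-! ### Singular chains, cocycles and the cap product -/

section

variable {M : Type*} [TopologicalSpace M]

theorem Simplex.restrict_restrict {k m n : ℕ} (s : Simplex M n) (θ : Fin (m + 1) → Fin (n + 1))
    (η : Fin (k + 1) → Fin (m + 1)) : (s.restrict θ).restrict η = s.restrict (θ ∘ η) := by
  ext t
  simp only [Simplex.restrict, ContinuousMap.comp_apply, ContinuousMap.coe_mk,
    stdSimplex.map_comp_apply]

theorem boundary_single_one (R : Type*) [CommRing R] (s : Simplex M 1) :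
    boundary R M 0 (Finsupp.single s 1) =
      Finsupp.single (s.restrict ![1]) 1 - Finsupp.single (s.restrict ![0]) 1 := by
  have f0 : (Fin.succAbove 0 : Fin 1 → Fin 2) = ![1] := by decide
  have f1 : (Fin.succAbove 1 : Fin 1 → Fin 2) = ![0] := by decide
  rw [boundary, Finsupp.linearCombination_single, one_smul, ← f0, ← f1]
  refine (Fin.sum_univ_two _).trans ?_
  simp [sub_eq_add_neg]

theorem boundary_single_two (R : Type*) [CommRing R] (s : Simplex M 2) :
    boundary R M 1 (Finsupp.single s 1) =
      Finsupp.single (s.restrict ![1, 2]) 1 - Finsupp.single (s.restrict ![0, 2]) 1 +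
        Finsupp.single (s.restrict ![0, 1]) 1 := by
  have f0 : (Fin.succAbove 0 : Fin 2 → Fin 3) = ![1, 2] := by decide
  have f1 : (Fin.succAbove 1 : Fin 2 → Fin 3) = ![0, 2] := by decide
  have f2 : (Fin.succAbove 2 : Fin 2 → Fin 3) = ![0, 1] := by decide
  rw [boundary, Finsupp.linearCombination_single, one_smul, ← f0, ← f1, ← f2]
  refine (Fin.sum_univ_three _).trans ?_
  simp [sub_eq_add_neg]

theorem boundary_single_three (R : Type*) [CommRing R] (s : Simplex M 3) :
    boundary R M 2 (Finsupp.single s 1) =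
      Finsupp.single (s.restrict ![1, 2, 3]) 1 - Finsupp.single (s.restrict ![0, 2, 3]) 1 +
        Finsupp.single (s.restrict ![0, 1, 3]) 1 - Finsupp.single (s.restrict ![0, 1, 2]) 1 := by
  have f0 : (Fin.succAbove 0 : Fin 3 → Fin 4) = ![1, 2, 3] := by decide
  have f1 : (Fin.succAbove 1 : Fin 3 → Fin 4) = ![0, 2, 3] := by decide
  have f2 : (Fin.succAbove 2 : Fin 3 → Fin 4) = ![0, 1, 3] := by decide
  have f3 : (Fin.succAbove 3 : Fin 3 → Fin 4) = ![0, 1, 2] := by decide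
  rw [boundary, Finsupp.linearCombination_single, one_smul, ← f0, ← f1, ← f2, ← f3]
  refine (Fin.sum_univ_four _).trans ?_
  simp [sub_eq_add_neg, Odd.neg_one_pow (show Odd 3 by decide)]

theorem boundary_boundary (R : Type*) [CommRing R] (c : Chain R M 2) :
    boundary R M 0 (boundary R M 1 c) = 0 := by
  suffices h : boundary R M 0 ∘ₗ boundary R M 1 = 0 from LinearMap.congr_fun h c
  refine Finsupp.lhom_ext' fun s => LinearMap.ext_ring ?_
  have f (i j : Fin 3) : (![i, j] : Fin 2 → Fin 3) ∘ ![0] = ![i] ∧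
      (![i, j] : Fin 2 → Fin 3) ∘ ![1] = ![j] := by
    constructor <;> ext x <;> fin_cases x <;> rfl
  simp only [LinearMap.comp_apply, Finsupp.lsingle_apply, boundary_single_two, map_sub, map_add,
    boundary_single_one, Simplex.restrict_restrict, f, LinearMap.zero_apply]
  abel

/-- The cap product of a 2-chain with a 1-cochain `α`, with the convention of `cap`:
`[v₀,v₁,v₂] ↦ α [v₀,v₁] • [v₁,v₂]`. -/
def capTwo (α : Chain ℤ M 1 →ₗ[ℤ] ℤ) : Chain ℤ M 2 →ₗ[ℤ] Chain ℤ M 1 :=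
  Finsupp.linearCombination ℤ fun s : Simplex M 2 =>
    Finsupp.single (s.restrict (m := 1) Fin.succ)
      (α (Finsupp.single (s.restrict (m := 1) ![0, 1]) 1))

/-- The cap product with a cocycle anticommutes with the boundary. -/
theorem boundary_cap (α : Chain ℤ M 1 →ₗ[ℤ] ℤ) (hα : ∀ τ, α (boundary ℤ M 1 τ) = 0)
    (c : Chain ℤ M 3) : boundary ℤ M 1 (cap α c) = -capTwo α (boundary ℤ M 2 c) := by
  suffices h : boundary ℤ M 1 ∘ₗ cap α = -(capTwo α ∘ₗ boundary ℤ M 2) from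
    LinearMap.congr_fun h c
  refine Finsupp.lhom_ext' fun s => LinearMap.ext_ring ?_
  have e (a : ℤ) (t : Simplex M 2) :
      Finsupp.single t a = a • (Finsupp.single t 1 : Chain ℤ M 2) := by simp
  have e' (a : ℤ) (t : Simplex M 1) :
      Finsupp.single t a = a • (Finsupp.single t 1 : Chain ℤ M 1) := by simp
  have f : (Fin.succ : Fin 3 → Fin 4) = ![1, 2, 3] := by decide
  have f' : (Fin.succ : Fin 2 → Fin 3) = ![1, 2] := by decide
  have g (i j k : Fin 4) : (![i, j, k] : Fin 3 → Fin 4) ∘ ![0, 1] = ![i, j] ∧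
      (![i, j, k] : Fin 3 → Fin 4) ∘ ![0, 2] = ![i, k] ∧
      (![i, j, k] : Fin 3 → Fin 4) ∘ ![1, 2] = ![j, k] := by
    refine ⟨?_, ?_, ?_⟩ <;> ext x <;> fin_cases x <;> rfl
  -- the cocycle condition on the front face `[v₀, v₁, v₂]`
  have hs := hα (Finsupp.single (s.restrict ![0, 1, 2]) 1)
  simp only [boundary_single_two, Simplex.restrict_restrict, g, map_sub, map_add] at hs
  simp only [LinearMap.comp_apply, LinearMap.neg_apply, Finsupp.lsingle_apply,
    boundary_single_three, map_sub, map_add, cap, capTwo, Finsupp.linearCombination_single, one_smul,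
    f, f', Simplex.restrict_restrict, g]
  rw [e (α _), map_smul, boundary_single_two, e' (α (Finsupp.single (s.restrict ![1, 2]) 1)),
    e' (α (Finsupp.single (s.restrict ![0, 2]) 1)),
    e' (α (Finsupp.single (s.restrict ![0, 1]) 1)) (s.restrict ![1, 3]),
    e' (α (Finsupp.single (s.restrict ![0, 1]) 1)) (s.restrict ![1, 2])]
  simp only [Simplex.restrict_restrict, g]
  rw [eq_sub_of_add_eq' hs]
  module

/-- The 1-cycles are a retract of the 1-chains. Points are grouped by the relation of being
homologous, a point `p u` is chosen in each class and a chain `γ u` from `p u` to `u`; then a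
1-simplex from `u` to `v` is sent to the cycle obtained by adding `γ u` and subtracting `γ v`.
This avoids the freeness of submodules of `Chain R M 0`. -/
theorem exists_retraction_cycles (R M : Type*) [CommRing R] [TopologicalSpace M] :
    ∃ r : Chain R M 1 →ₗ[R] Chain R M 1,
      (∀ c, boundary R M 0 (r c) = 0) ∧ ∀ c, boundary R M 0 c = 0 → r c = c := by
  let S : Setoid (Simplex M 0) :=
    { r := fun u v => ∃ c : Chain R M 1,
        boundary R M 0 c = Finsupp.single u 1 - Finsupp.single v 1
      iseqv :=
        { refl := fun u => ⟨0, by simp⟩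
          symm := fun ⟨c, hc⟩ => ⟨-c, by rw [map_neg, hc, neg_sub]⟩
          trans := fun ⟨c, hc⟩ ⟨d, hd⟩ => ⟨c + d, by rw [map_add, hc, hd, sub_add_sub_cancel]⟩ } }
  let p : Simplex M 0 → Simplex M 0 := fun u => (Quotient.mk S u).out
  have hp : ∀ u, ∃ c : Chain R M 1,
      boundary R M 0 c = Finsupp.single u 1 - Finsupp.single (p u) 1 :=
    fun u => S.symm (Quotient.mk_out (s := S) u)
  choose γ hγ using hp
  let P : Chain R M 0 →ₗ[R] Chain R M 0 :=
    Finsupp.linearCombination R fun u => Finsupp.single (p u) 1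
  let h : Chain R M 0 →ₗ[R] Chain R M 1 := Finsupp.linearCombination R γ
  have hh : ∀ x, boundary R M 0 (h x) = x - P x := by
    intro x
    suffices H : boundary R M 0 ∘ₗ h = LinearMap.id - P from LinearMap.congr_fun H x
    refine Finsupp.lhom_ext' fun u => LinearMap.ext_ring ?_
    simp [h, P, hγ]
  have hP : ∀ c, P (boundary R M 0 c) = 0 := by
    intro c
    suffices H : P ∘ₗ boundary R M 0 = 0 from LinearMap.congr_fun H c
    refine Finsupp.lhom_ext' fun s => LinearMap.ext_ring ?_
    have hs : p (s.restrict ![1]) = p (s.restrict ![0]) := by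
      refine congrArg Quotient.out (Quotient.sound (s := S) ⟨Finsupp.single s 1, ?_⟩)
      exact boundary_single_one R s
    refine (congrArg P (boundary_single_one R s)).trans ?_
    simp [P, hs]
  refine ⟨LinearMap.id - h ∘ₗ boundary R M 0, fun c => ?_, fun c hc => ?_⟩
  · simp [hh, hP]
  · simp [hc]

theorem H1.mk_boundary (R : Type*) [CommRing R] (τ : Chain R M 2) :
    H1.mk (boundary R M 1 τ) (boundary_boundary R τ) = 0 :=
  (Submodule.Quotient.mk_eq_zero _).2 ⟨τ, rfl⟩

/-- `H1.mk` as a linear map. -/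
def H1.mkLinear (R M : Type*) [CommRing R] [TopologicalSpace M] :
    LinearMap.ker (boundary R M 0) →ₗ[R] H1 R M where
  toFun z := H1.mk z.1 z.2
  map_add' _ _ := rfl
  map_smul' _ _ := rfl

theorem H1.mkLinear_apply {R : Type*} [CommRing R] (z : Chain R M 1)
    (hz : boundary R M 0 z = 0) : H1.mkLinear R M ⟨z, hz⟩ = H1.mk z hz := rfl

theorem H1.mkLinear_surjective (R M : Type*) [CommRing R] [TopologicalSpace M] :
    Function.Surjective (H1.mkLinear R M) := Submodule.Quotient.mk_surjective _

/-- The part of the universal coefficient theorem that is used here: every functional on `H₁` is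
given by a cocycle. -/
theorem exists_cocycle {R : Type*} [CommRing R] (φ : H1 R M →ₗ[R] R) :
    ∃ α : Chain R M 1 →ₗ[R] R, (∀ τ, α (boundary R M 1 τ) = 0) ∧
      ∀ z hz, α z = φ (H1.mk z hz) := by
  obtain ⟨r, hr, hr'⟩ := exists_retraction_cycles R M
  have key : ∀ z hz, (φ ∘ₗ H1.mkLinear R M ∘ₗ r.codRestrict _ hr) z = φ (H1.mk z hz) := by
    intro z hz
    have : r.codRestrict _ hr z = (⟨z, hz⟩ : LinearMap.ker (boundary R M 0)) :=
      Subtype.ext (hr' z hz)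
    rw [LinearMap.comp_apply, LinearMap.comp_apply, this, H1.mkLinear_apply]
  refine ⟨φ ∘ₗ H1.mkLinear R M ∘ₗ r.codRestrict _ hr, fun τ => ?_, key⟩
  rw [key _ (boundary_boundary R τ), H1.mk_boundary, map_zero]

/-- Every functional on `H₁(M; ℤ)` is the intersection pairing with a class in `H₂(M)`, namely the
cap product of the fundamental class with a cocycle that represents the functional. -/
theorem exists_closed_surface {μ : Chain ℤ M 3} (hμ : boundary ℤ M 2 μ = 0)
    (φ : H1 ℤ M →ₗ[ℤ] ℤ) :
    ∃ σ : Chain ℤ M 2, boundary ℤ M 1 σ = 0 ∧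
      ∀ c : C(Circle, M), IsIntersectionNumber μ ∅ σ (loopChain ℤ c) (φ (loopClass ℤ c)) := by
  obtain ⟨α, hα, hφ⟩ := exists_cocycle φ
  refine ⟨cap α μ, by rw [boundary_cap α hα, hμ, map_zero, neg_zero], fun c =>
    ⟨α, ⟨fun τ _ => hα τ, fun N _ _ => ?_⟩, hφ _ _⟩⟩
  -- As `K = ∅`, the fundamental cycle itself lies in the complement of `K`.
  refine ⟨μ, ?_, 0, zero_mem _, 0, zero_mem _, by simp, by simp⟩
  simp [chainsIn]

/-! ### From integral to rational homology -/

/-- Extension of scalars from `ℤ` to `ℚ` on chains. -/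
def toRatChain (M : Type*) [TopologicalSpace M] (n : ℕ) : Chain ℤ M n →+ Chain ℚ M n :=
  Finsupp.mapRange.addMonoidHom (Int.castAddHom ℚ)

theorem toRatChain_single {n : ℕ} (s : Simplex M n) (a : ℤ) :
    toRatChain M n (Finsupp.single s a) = Finsupp.single s (a : ℚ) := by
  simp [toRatChain]

theorem toRatChain_injective (n : ℕ) : Function.Injective (toRatChain M n) :=
  Finsupp.mapRange_injective _ Int.cast_zero Int.cast_injective

theorem boundary_toRatChain {n : ℕ} (c : Chain ℤ M (n + 1)) :
    boundary ℚ M n (toRatChain M (n + 1) c) = toRatChain M n (boundary ℤ M n c) := by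
  induction c using Finsupp.induction_linear with
  | zero => simp
  | add f g hf hg => simp only [map_add, hf, hg]
  | single s a =>
    rw [toRatChain_single]
    simp only [boundary, Finsupp.linearCombination_single, Finset.smul_sum, map_sum,
      Finsupp.smul_single, toRatChain_single]
    simp

/-- Extension of scalars `H₁(M; ℤ) → H₁(M; ℚ)`. -/
def toRatH1 (M : Type*) [TopologicalSpace M] : H1 ℤ M →+ H1 ℚ M :=
  QuotientAddGroup.lift _
    ((Submodule.mkQ ((LinearMap.range (boundary ℚ M 1)).submoduleOf
      (LinearMap.ker (boundary ℚ M 0)))).toAddMonoidHom.comp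
      (((toRatChain M 1).comp (LinearMap.ker (boundary ℤ M 0)).subtype.toAddMonoidHom).codRestrict
        (LinearMap.ker (boundary ℚ M 0)) fun z => by
          have hz := z.2
          rw [LinearMap.mem_ker] at hz
          simp [boundary_toRatChain, hz]))
    (by
      rintro z ⟨τ, hτ⟩
      refine (Submodule.Quotient.mk_eq_zero _).2 ⟨toRatChain M 2 τ, ?_⟩
      rw [boundary_toRatChain, hτ]
      rfl)

theorem toRatH1_mk (z : Chain ℤ M 1) (hz : boundary ℤ M 0 z = 0) :
    toRatH1 M (H1.mk z hz) =
      H1.mk (toRatChain M 1 z) (by rw [boundary_toRatChain, hz, map_zero]) := rfl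

theorem toRatH1_loopClass (c : C(Circle, M)) :
    toRatH1 M (loopClass ℤ c) = loopClass ℚ c := by
  rw [loopClass, toRatH1_mk, loopClass]
  congr 1
  simp [loopChain, toRatChain_single]

theorem exists_zsmul_mem_range_toRatChain {n : ℕ} (c : Chain ℚ M n) :
    ∃ k : ℤ, k ≠ 0 ∧ ∃ w, toRatChain M n w = k • c := by
  induction c using Finsupp.induction_linear with
  | zero => exact ⟨1, one_ne_zero, 0, by simp⟩
  | add f g hf hg =>
    obtain ⟨k, hk, v, hv⟩ := hf
    obtain ⟨l, hl, w, hw⟩ := hg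
    refine ⟨l * k, mul_ne_zero hl hk, l • v + k • w, ?_⟩
    rw [map_add, map_zsmul, map_zsmul, hv, hw, smul_add, mul_smul, mul_comm, mul_smul]
  | single s a =>
    refine ⟨a.den, by simp, Finsupp.single s a.num, ?_⟩
    rw [toRatChain_single, Finsupp.smul_single]
    congr 1
    rw [zsmul_eq_mul, Int.cast_natCast, mul_comm, Rat.mul_den_eq_num]

theorem exists_zsmul_mem_range_toRatH1 (y : H1 ℚ M) :
    ∃ k : ℤ, k ≠ 0 ∧ ∃ x, toRatH1 M x = k • y := by
  obtain ⟨⟨z, hz⟩, rfl⟩ := H1.mkLinear_surjective ℚ M y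
  obtain ⟨k, hk, w, hw⟩ := exists_zsmul_mem_range_toRatChain z
  have hw' : boundary ℤ M 0 w = 0 := by
    apply toRatChain_injective
    rw [← boundary_toRatChain, hw, map_zsmul, LinearMap.mem_ker.1 hz, smul_zero, map_zero]
  refine ⟨k, hk, H1.mk w hw', ?_⟩
  rw [toRatH1_mk, ← H1.mkLinear_apply, ← map_zsmul]
  exact congrArg _ (Subtype.ext hw)

/-- If the components indexed by `S` generate `H₁(M; ℤ)` up to torsion, they span `H₁(M; ℚ)`. -/
theorem FramedLink.spans_rat_of_torsion {ι : Type*} (b : FramedLink ι M) (S : Set ι)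
    (h : ∀ x : H1 ℤ M, ∃ k : ℤ, k ≠ 0 ∧
      k • x ∈ Submodule.span ℤ ((fun i => loopClass ℤ (b.core i)) '' S)) : b.Spans ℚ S := by
  have key : ∀ x ∈ Submodule.span ℤ ((fun i => loopClass ℤ (b.core i)) '' S),
      toRatH1 M x ∈ Submodule.span ℚ ((fun i => loopClass ℚ (b.core i)) '' S) := by
    intro x hx
    induction hx using Submodule.span_induction with
    | mem x hx =>
      obtain ⟨i, hi, rfl⟩ := hx
      exact Submodule.subset_span ⟨i, hi, (toRatH1_loopClass _).symm⟩
    | zero => simp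
    | add x y _ _ hx hy => rw [map_add]; exact add_mem hx hy
    | smul a x _ hx => rw [map_zsmul]; exact zsmul_mem hx a
  rw [FramedLink.Spans, eq_top_iff]
  intro y _
  obtain ⟨k, hk, x, hx⟩ := exists_zsmul_mem_range_toRatH1 y
  obtain ⟨l, hl, hlx⟩ := h x
  have := key _ hlx
  rw [map_zsmul, hx, smul_smul, ← Int.cast_smul_eq_zsmul ℚ] at this
  exact (Submodule.smul_mem_iff _ (Int.cast_ne_zero.2 (mul_ne_zero hl hk))).1 this

end

/-! ### Cutting an internal edge -/

namespace UTGraph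

/-- The graph obtained by cutting the internal edge `{h, edge h}` into two edges that end at the
new legs `inr false` (on the side of `h`) and `inr true` (on the side of `edge h`). -/
def cut (Γ : UTGraph) (h : Γ.H) (h1 : Γ.vert h ≠ h) (h2 : Γ.vert (Γ.edge h) ≠ Γ.edge h) :
    UTGraph where
  H := Γ.H ⊕ Bool
  finite := inferInstance
  edge
    | .inl x => if x = h then .inr false else if x = Γ.edge h then .inr true else .inl (Γ.edge x)
    | .inr false => .inl h
    | .inr true => .inl (Γ.edge h)
  vert
    | .inl x => .inl (Γ.vert x)
    | .inr t => .inr t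
  edge_edge := by
    have e := Γ.edge_edge
    have n := Γ.edge_ne
    rintro (x | _ | _) <;> grind
  edge_ne := by
    have n := Γ.edge_ne
    rintro (x | _ | _) <;> grind
  vert_cube := by
    rintro (x | _ | _) <;> simp [Γ.vert_cube]
  no_strut := by
    have n := Γ.no_strut
    rintro (x | _ | _) <;> grind

end UTGraph

section

variable {X : Type*}

/-- The graph obtained from `G` by cutting the internal edge `{h, edge h}`, in which the new leg
on the side of `edge h` is distinguished and the one on the side of `h` is colored by `x`. -/
def ColoredGraph.cut (G : ColoredGraph X) (h : G.H) (h1 : G.vert h ≠ h)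
    (h2 : G.vert (G.edge h) ≠ G.edge h) (x : X) : StarGraph X where
  toUTGraph := G.toUTGraph.cut h h1 h2
  star := ⟨.inr true, rfl⟩
  color
    | ⟨⟨.inl y, hy⟩, _⟩ => G.color ⟨y, Sum.inl_injective hy⟩
    | ⟨⟨.inr _, _⟩, _⟩ => x

/-- The new leg of a cut graph that is not the distinguished one. -/
def ColoredGraph.cutLeg (G : ColoredGraph X) (h : G.H) (h1 : G.vert h ≠ h)
    (h2 : G.vert (G.edge h) ≠ G.edge h) (x : X) :
    {l : (G.cut h h1 h2 x).Leg // l ≠ (G.cut h h1 h2 x).star} :=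
  ⟨⟨.inr false, rfl⟩, fun e => by
    have : (Sum.inr false : G.H ⊕ Bool) = Sum.inr true := congrArg Subtype.val e
    simp at this⟩

/-- Gluing the two new legs of a cut graph restores the graph. -/
theorem ColoredGraph.isomorphic_glue_cut (G : ColoredGraph X) (h : G.H) (h1 : G.vert h ≠ h)
    (h2 : G.vert (G.edge h) ≠ G.edge h) (x : X) :
    G.Isomorphic ((G.cut h h1 h2 x).glue (G.cutLeg h h1 h2 x)) := by
  let e : G.H ≃ {y : G.H ⊕ Bool // y ≠ .inr true ∧ y ≠ .inr false} :=
    { toFun := fun y => ⟨.inl y, by simp⟩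
      invFun := fun
        | ⟨.inl y, _⟩ => y
        | ⟨.inr true, hy⟩ => (hy.1 rfl).elim
        | ⟨.inr false, hy⟩ => (hy.2 rfl).elim
      left_inv := fun _ => rfl
      right_inv := by rintro ⟨y | _ | _, hy⟩ <;> simp at hy ⊢ }
  refine ⟨e, fun y => ?_, fun y => rfl, ?_⟩
  · have ee := G.edge_edge
    have key : ∀ (hy : (Sum.inl y : G.H ⊕ Bool) ≠ .inr true ∧ Sum.inl y ≠ .inr false),
        (((G.cut h h1 h2 x).glue (G.cutLeg h h1 h2 x)).edge ⟨.inl y, hy⟩).1 =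
          .inl (G.edge y) := by
      intro hy
      simp only [StarGraph.glue, UTGraph.glue, ColoredGraph.cut, UTGraph.cut, ColoredGraph.cutLeg]
      split_ifs <;> grind
    exact Subtype.ext (key _).symm
  · rintro ⟨y, hy⟩ ⟨⟨z, hz⟩, hz'⟩ hyz
    obtain rfl : Sum.inl y = z := congrArg Subtype.val hyz
    rfl

theorem toB_eq_of_isomorphic {G G' : ColoredGraph X} (h : G.Isomorphic G') : toB G = toB G' := by
  refine (QuotientAddGroup.eq_iff_sub_mem).2 (AddSubgroup.subset_closure ?_)
  exact .inl (.inl (.inl ⟨G, G', h, rfl⟩))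

/-- If `n` vanishes on the colors of `G`, then only the new leg contributes to the gluing sum of a
cut of `G`. -/
theorem gluingSum_cut (n : X → ℤ) (G : ColoredGraph X) (hn : ∀ l, n (G.color l) = 0) (h : G.H)
    (h1 : G.vert h ≠ h) (h2 : G.vert (G.edge h) ≠ G.edge h) (x : X) :
    gluingSum n (G.cut h h1 h2 x) = n x • toB G := by
  rw [gluingSum, Finset.sum_eq_single (G.cutLeg h h1 h2 x),
    ← toB_eq_of_isomorphic (G.isomorphic_glue_cut h h1 h2 x)]
  · rfl
  · rintro ⟨⟨y | _ | _, hy⟩, hy'⟩ _ hne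
    · exact (congrArg (· • _) (hn _)).trans (zero_smul _ _)
    · exact (hne rfl).elim
    · exact (hy' rfl).elim
  · simp

end

/-! ### Vanishing of graphs with an internal edge -/

section

variable {M : Type*} [TopologicalSpace M] {ι : Type*}

theorem toAo_eq_zero_of_toB_mem {μ : Chain ℤ M 3} {b : FramedLink ι M} {G : ColoredGraph ι}
    (h : toB G ∈ AddSubgroup.closure (brRelations μ b)) : toAo μ b G = 0 := by
  rw [toAo, (QuotientAddGroup.eq_zero_iff _).2 h, QuotientAddGroup.mk_zero]

theorem toAo_eq_zero_of_hasInternalEdge {μ : Chain ℤ M 3} (hμ : boundary ℤ M 2 μ = 0) [Finite ι]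
    {b : FramedLink ι M} (hb : b.IsH1Spanning) {S : Set ι} (hS : ¬ b.Spans ℚ S)
    {G : ColoredGraph ι} (hG : ∀ l, G.color l ∈ S) (h : G.HasInternalEdge) : toAo μ b G = 0 := by
  have hb' : Submodule.span ℤ (Set.range fun i => loopClass ℤ (b.core i)) = ⊤ := by
    rw [← Set.image_univ]; exact hb
  obtain ⟨x, hx⟩ : ∃ x : H1 ℤ M, ∀ k : ℤ, k ≠ 0 →
      k • x ∉ Submodule.span ℤ ((fun i => loopClass ℤ (b.core i)) '' S) := by
    have := mt (b.spans_rat_of_torsion S) hS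
    push Not at this
    exact this
  obtain ⟨φ, hφS, hφ⟩ := exists_linearMap_vanishing_of_not_torsion _ hb' S hx
  obtain ⟨σ, hσ, hσφ⟩ := exists_closed_surface hμ φ
  obtain ⟨e, h1, h2⟩ := h
  let n : ι → ℤ := fun i => φ (loopClass ℤ (b.core i))
  have hrel : ∀ i, n i • (toB G : GroupB ι) ∈ AddSubgroup.closure (brRelations μ b) := fun i =>
    AddSubgroup.subset_closure ⟨G.cut e h1 h2 i, σ, n, hσ, fun j => hσφ (b.core j),
      (gluingSum_cut n G (fun l => hφS _ (hG l)) e h1 h2 i).symm⟩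
  apply toAo_eq_zero_of_toB_mem
  rw [← QuotientAddGroup.eq_zero_iff]
  refine eq_zero_of_forall_smul_eq_zero _ hb' φ hφ fun i => ?_
  exact (QuotientAddGroup.eq_zero_iff _).2 (hrel i)

theorem FramedLink.not_spans_rat_empty (b : FramedLink ι M) (h : 0 < b1 M) :
    ¬ b.Spans ℚ ∅ := by
  intro hs
  rw [Spans, Set.image_empty, Submodule.span_empty] at hs
  have := Module.nontrivial_of_finrank_pos h
  exact bot_ne_top hs

theorem UTGraph.hasInternalEdge_of_isEmpty_leg (Γ : UTGraph) [Nonempty Γ.H] [IsEmpty Γ.Leg] :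
    Γ.HasInternalEdge :=
  have h : ∀ x, Γ.vert x ≠ x := fun x hx => isEmptyElim (⟨x, hx⟩ : Γ.Leg)
  ⟨Classical.arbitrary _, h _, h _⟩

end

end FTI

end

theorem corollary3 {M : Type*} [TopologicalSpace M] [T2Space M] [CompactSpace M]
    [ChartedSpace (EuclideanSpace ℝ (Fin 3)) M]
    (μ : FTI.Chain ℤ M 3) (hμ : FTI.IsFundamentalCycle μ)
    {ι : Type*} [Finite ι] (b : FTI.FramedLink ι M) (hb : b.IsH1Spanning) :
    (∀ S : Set ι, ¬ b.Spans ℚ S →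
      ∀ G : FTI.ColoredGraph ι, (∀ l, G.color l ∈ S) → G.HasInternalEdge →
        FTI.toAo μ b G = 0) ∧
    (0 < FTI.b1 M →
      ∀ G : FTI.ColoredGraph ι, Nonempty G.H → IsEmpty G.Leg → FTI.toAo μ b G = 0) := by
  refine ⟨fun S hS G hG h => FTI.toAo_eq_zero_of_hasInternalEdge hμ.1 hb hS hG h,
    fun h G _ _ => ?_⟩
  exact FTI.toAo_eq_zero_of_hasInternalEdge hμ.1 hb (b.not_spans_rat_empty h) isEmptyElim
    G.toUTGraph.hasInternalEdge_of_isEmpty_leg
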